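/- Theorem (colored Gaussian noise added prior to measurement, "noise folding"). Let $n\ge 1$, let $x\sim\mathcal N(\mu,\Sigma)$ be a Gaussian signal in $\mathbb R^n$ ($\Sigma$ symmetric positive semidefinite, possibly singular), and let $\Sigma_w$ be a symmetric positive definite $n\times n$ matrix. The measurement number $t$ with a vector $a$ has the outcome $y_t=a^{\top}(x+w_t)$, where $w_0,w_1,\dots\sim\mathcal N(0,\Sigma_w)$ are independent of each other and of $x$. Let $\varepsilon>0$ and $0<p<1$, let $\chi_n^2(p)$ be the $p$-quantile of the chi-squared distribution with $n$ degrees of freedom, let $\|\cdot\|$ denote the Euclidean norm of vectors and the spectral norm of matrices, and let $\lambda_1,\dots,\lambda_n$ be the eigenvalues of $\Sigma_w^{-1}\Sigma$ with multiplicities (they are real and nonnegative). Consider the following algorithm. It maintains a mean and a covariance matrix, initially $\mu$ and $\Sigma$ (the symbols $\mu,\Sigma$ stand for the current values), and repeats the following pass, at least once, until $\|\Sigma\|\le\varepsilon^2/\chi_n^2(p)$: 1. Let $\lambda$ be the largest eigenvalue of $\Sigma_w^{-1}\Sigma$, let $u$ be an eigenvector of $\Sigma_w^{-1}\Sigma$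 for $\lambda$ with $\|u\|=1$ (ties are broken by an arbitrary fixed rule that depends only on the current $\Sigma$), and let $\beta=\max\{0,\ \frac{\chi_n^2(p)}{\varepsilon^2}\|\Sigma_w\|-\frac1\lambda\}$, with $\beta=0$ if $\lambda=0$. 2. Measure $r$ times with the unit vector $u$. If $\beta=0$ then $r=0$. Otherwise $r$ is an integer with $1\le r\le\lceil\beta\rceil$, chosen by an arbitrary fixed rule that depends only on the current $\Sigma$; so $r=\lceil\beta\rceil$ (the whole power is spent in one pass) and $r=1$ (one measurement per pass) are both allowed. After each of these measurements, with outcome $y$, simultaneously update $$\mu\leftarrow\mu+\Sigma u\,(u^{\top}\Sigma u+u^{\top}\Sigma_w u)^{-1}(y-u^{\top}\mu),\qquad \Sigma\leftarrow\Sigma-\Sigma u\,(u^{\top}\Sigma u+u^{\top}\Sigma_w u)^{-1}u^{\top}\Sigma .$$ On termination the algorithm returns the current mean $\widehat x=\mu$. Then, for every choice of these rules, the algorithm always terminates, it uses at most $$m=\sum_{\substack{1\le i\le n\\ \lambda_i\ne0}}\max\Bigl\{0,\Bigl\lceil\frac{\chi_n^2(p)}{\varepsilon^2}\|\Sigma_w\|-\frac1{\lambda_i}\Bigr\rceil\Bigr\}$$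 measurements, all of them by unit vectors, where the $\lambda_i$ belong to the initial $\Sigma$, and $\Pr\bigl(\|x-\widehat x\|<\varepsilon\bigr)\ge p$. -/

import Mathlib

open MeasureTheory ProbabilityTheory

noncomputable section

namespace InfoGreedy

/-- The spectral norm of a real square matrix: its operator norm on Euclidean space. -/
def specNorm {n : ℕ} (M : Matrix (Fin n) (Fin n) ℝ) : ℝ :=
  ‖Matrix.toEuclideanCLM (n := Fin n) (𝕜 := ℝ) M‖

/-- The largest real eigenvalue of a real square matrix. -/
def maxEigenvalue {n : ℕ} (M : Matrix (Fin n) (Fin n) ℝ) : ℝ :=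
  sSup {l : ℝ | Module.End.HasEigenvalue (Matrix.toLin' M) l}

/-- The chi-squared distribution with `n` degrees of freedom: the law of the sum of the squares
of `n` independent standard normal variables. -/
def chiSq (n : ℕ) : Measure ℝ :=
  (Measure.pi (fun _ : Fin n => gaussianReal 0 1)).map (fun z => ∑ i, z i ^ 2)

/-- The quantile function of the chi-squared distribution with `n` degrees of freedom. -/
def chiSqQuantile (n : ℕ) (p : ℝ) : ℝ :=
  sInf {t : ℝ | p ≤ cdf (chiSq n) t}

/-- The state of the algorithm: posterior mean, posterior covariance matrix, and the number of
measurements taken so far. -/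
structure State (n : ℕ) where
  mean : EuclideanSpace ℝ (Fin n)
  cov : Matrix (Fin n) (Fin n) ℝ
  count : ℕ

/-- One measurement with the vector `a`. Here `meas t a` is the outcome of the measurement
number `t` (counted from `0`) when it is made with the vector `a`. With `s = aᵀ Σ a + aᵀ Σw a`,
the update is `μ ← μ + Σ a s⁻¹ (y - aᵀ μ)` and `Σ ← Σ - Σ a s⁻¹ aᵀ Σ`. -/
def measureOnce {n : ℕ} (Sw : Matrix (Fin n) (Fin n) ℝ)
    (meas : ℕ → EuclideanSpace ℝ (Fin n) → ℝ) (a : EuclideanSpace ℝ (Fin n))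
    (s : State n) : State n :=
  let v : Fin n → ℝ := a.ofLp
  let tot : ℝ := v ⬝ᵥ s.cov.mulVec v + v ⬝ᵥ Sw.mulVec v
  let y : ℝ := meas s.count a
  { mean := s.mean + (tot⁻¹ * (y - inner ℝ a s.mean)) • WithLp.toLp 2 (s.cov.mulVec v)
    cov := s.cov - tot⁻¹ • Matrix.vecMulVec (s.cov.mulVec v) (Matrix.vecMul v s.cov)
    count := s.count + 1 }

/-- The power `β = max {0, (χ²_n(p) / ε²) ‖Σw‖ - 1 / λ}` with `λ` the largest eigenvalue of
`Σw⁻¹ Σ`. For `λ = 0` (so `1 / λ = ∞`) the power is `0`. -/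
def power {n : ℕ} (Sw : Matrix (Fin n) (Fin n) ℝ) (ε p : ℝ)
    (S : Matrix (Fin n) (Fin n) ℝ) : ℝ :=
  if maxEigenvalue (Sw⁻¹ * S) = 0 then 0
  else max 0 (chiSqQuantile n p / ε ^ 2 * specNorm Sw - 1 / maxEigenvalue (Sw⁻¹ * S))

/-- `u` selects, for each covariance matrix `Σ`, a unit eigenvector of `Σw⁻¹ Σ` for its largest
eigenvalue (ties are broken arbitrarily). -/
def IsDirectionRule {n : ℕ} (Sw : Matrix (Fin n) (Fin n) ℝ)
    (u : Matrix (Fin n) (Fin n) ℝ → EuclideanSpace ℝ (Fin n)) : Prop :=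
  ∀ S : Matrix (Fin n) (Fin n) ℝ, S.PosSemidef →
    ‖u S‖ = 1 ∧
    Module.End.HasEigenvector (Matrix.toLin' (Sw⁻¹ * S)) (maxEigenvalue (Sw⁻¹ * S)) (u S).ofLp

/-- `r` selects, for each covariance matrix, how often the unit-vector measurement is repeated in
one pass of the loop. Allowed are all choices between `⌈β⌉` repetitions (the whole power `β` is
spent in one pass) and a single measurement per pass; there is none if `β = 0`. -/
def IsRepetitionRule {n : ℕ} (Sw : Matrix (Fin n) (Fin n) ℝ) (ε p : ℝ)
    (r : Matrix (Fin n) (Fin n) ℝ → ℕ) : Prop :=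
  ∀ S : Matrix (Fin n) (Fin n) ℝ, S.PosSemidef →
    min 1 ⌈power Sw ε p S⌉₊ ≤ r S ∧ r S ≤ ⌈power Sw ε p S⌉₊

/-- One pass of the loop: `r Σ` measurements with the vector `u Σ`, where `Σ` is the covariance
matrix at the beginning of the pass, each followed by an update of mean and covariance. -/
def loopBody {n : ℕ} (Sw : Matrix (Fin n) (Fin n) ℝ)
    (u : Matrix (Fin n) (Fin n) ℝ → EuclideanSpace ℝ (Fin n))
    (r : Matrix (Fin n) (Fin n) ℝ → ℕ)
    (meas : ℕ → EuclideanSpace ℝ (Fin n) → ℝ) (s : State n) : State n :=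
  (measureOnce Sw meas (u s.cov))^[r s.cov] s

/-- `RepeatUntil body crit s t`: the loop `repeat body until crit`, started in `s`, terminates
in `t`. -/
inductive RepeatUntil {σ : Type*} (body : σ → σ) (crit : σ → Prop) : σ → σ → Prop
  | halt (s : σ) : crit (body s) → RepeatUntil body crit s (body s)
  | again (s t : σ) : ¬ crit (body s) → RepeatUntil body crit (body s) t →
      RepeatUntil body crit s t

/-- `Outputs … fin`: Info-Greedy Sensing for colored noise added prior to measurement, started
with signal mean `μ`, signal covariance `S` and noise covariance `Sw`, terminates in the state
`fin`. -/
def Outputs {n : ℕ} (μ : EuclideanSpace ℝ (Fin n)) (S Sw : Matrix (Fin n) (Fin n) ℝ) (ε p : ℝ)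
    (u : Matrix (Fin n) (Fin n) ℝ → EuclideanSpace ℝ (Fin n))
    (r : Matrix (Fin n) (Fin n) ℝ → ℕ)
    (meas : ℕ → EuclideanSpace ℝ (Fin n) → ℝ) (fin : State n) : Prop :=
  RepeatUntil (loopBody Sw u r meas)
    (fun s => specNorm s.cov ≤ ε ^ 2 / chiSqQuantile n p) ⟨μ, S, 0⟩ fin

/-- The number `∑_{λ_i ≠ 0} max {0, ⌈(χ²_n(p) / ε²) ‖Σw‖ - 1 / λ_i⌉}`, where the `λ_i` are the
eigenvalues of `Σw⁻¹ Σ` with multiplicities. -/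
def measurementBound {n : ℕ} (S Sw : Matrix (Fin n) (Fin n) ℝ) (ε p : ℝ) : ℤ :=
  (((Sw⁻¹ * S).charpoly.roots.filter (fun l => l ≠ 0)).map
    (fun l => max 0 ⌈chiSqQuantile n p / ε ^ 2 * specNorm Sw - 1 / l⌉)).sum

end InfoGreedy

end

noncomputable section

namespace InfoGreedy

open Matrix Polynomial

/-! A measurement along a generalized eigenvector `S a = l Sw a` moves a single eigenvalue of `Sw⁻¹
S`: `l` becomes `l / (1 + l)`, so `1 / l` grows by exactly 1. Let `q` be the chi-squared quantile
and `c = (q / ε²) ‖Sw‖`. An eigenvalue `l ≠ 0` has the deficit `max 0 ⌈c - 1 / l⌉`; the sum of the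
deficits is the claimed bound, and every measurement that the rules permit lowers it by 1
(`potential_foldl_replicate`). If the largest eigenvalue `l` has no deficit, then `S ≤ l Sw` gives
`‖S‖ ≤ l ‖Sw‖ ≤ ε² / q` and the loop stops. This yields termination and the count
(`exists_directions`).

The directions are determined by the covariances alone, never by the outcomes. For a fixed list of
directions the error is a fixed linear image of `x - μ` and the noises, whose covariance is the
computed matrix `T` (`exists_error_eq`). So the error is a centred Gaussian, and no conditioning is
needed. It has the law of `√T z` with `z` standard Gaussian; since `‖√T z‖² ≤ ‖T‖ ‖z‖²`, its norm is
below `ε` once `‖z‖² < q`, an event of probability at least `p`. -/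

/-! ### Rank-one perturbation of an eigenvalue -/

/-- Since `(x - A) u = (x - l) u`, the perturbed matrix `x - A + g u vᵀ` factors as `(x - A) (1 + (g
/ (x - l)) u vᵀ)` for `x ≠ l`, and the matrix determinant lemma evaluates the second factor.
Agreement at infinitely many `x` suffices. -/
theorem charpoly_sub_smul_vecMulVec {ι K : Type*} [Fintype ι] [DecidableEq ι] [Field K]
    [Infinite K] (A : Matrix ι ι K) (u v : ι → K) (l g : K) (hu : A *ᵥ u = l • u)
    (hv : v ⬝ᵥ u = 1) :
    (X - C l) * (A - g • vecMulVec u v).charpoly = (X - C (l - g)) * A.charpoly := by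
  refine Polynomial.eq_of_infinite_eval_eq _ _
    ((Set.finite_singleton l).infinite_compl.mono fun x hx => ?_)
  have hxl : x - l ≠ 0 := sub_ne_zero.2 hx
  have hfac : scalar ι x - (A - g • vecMulVec u v)
      = (scalar ι x - A) * (1 + vecMulVec ((g / (x - l)) • u) v) := by
    have h1 : (scalar ι x - A) *ᵥ ((g / (x - l)) • u) = g • u := by
      rw [mulVec_smul, sub_mulVec, hu]
      ext i
      simp only [scalar_apply, mulVec_diagonal, Pi.smul_apply, Pi.sub_apply, smul_eq_mul]
      field_simp
    rw [mul_add, mul_one, mul_vecMulVec, h1, smul_vecMulVec]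
    abel
  have hdet : (1 + vecMulVec ((g / (x - l)) • u) v).det = 1 + g / (x - l) := by
    rw [vecMulVec_eq Unit, det_one_add_replicateCol_mul_replicateRow, dotProduct_smul, hv,
      smul_eq_mul, mul_one]
  simp only [Set.mem_ofPred_eq, eval_mul, eval_sub, eval_X, eval_C, eval_charpoly]
  rw [hfac, det_mul, hdet]
  field_simp
  ring

theorem cons_roots_charpoly_sub_smul_vecMulVec {ι K : Type*} [Fintype ι] [DecidableEq ι] [Field K]
    [Infinite K] (A : Matrix ι ι K) (u v : ι → K) (l g : K) (hu : A *ᵥ u = l • u)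
    (hv : v ⬝ᵥ u = 1) :
    l ::ₘ (A - g • vecMulVec u v).charpoly.roots = (l - g) ::ₘ A.charpoly.roots := by
  have h := congrArg roots (charpoly_sub_smul_vecMulVec A u v l g hu hv)
  rwa [roots_mul (mul_ne_zero (X_sub_C_ne_zero _) (charpoly_monic _).ne_zero),
    roots_mul (mul_ne_zero (X_sub_C_ne_zero _) (charpoly_monic _).ne_zero),
    roots_X_sub_C, roots_X_sub_C, Multiset.singleton_add, Multiset.singleton_add] at h

/-! ### Generalized eigenvalues and the spectral norm -/

variable {n : ℕ}

theorem mulVec_eq_smul_mulVec {S Sw : Matrix (Fin n) (Fin n) ℝ} (hSw : Sw.PosDef)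
    {l : ℝ} {v : Fin n → ℝ} : (Sw⁻¹ * S) *ᵥ v = l • v ↔ S *ᵥ v = l • Sw *ᵥ v := by
  have hdet : IsUnit Sw.det := (isUnit_iff_isUnit_det _).1 hSw.isUnit
  constructor
  · intro h
    rw [← mulVec_smul, ← h, mulVec_mulVec, mul_nonsing_inv_cancel_left _ _ hdet]
  · intro h
    rw [← mulVec_mulVec, h, mulVec_smul, mulVec_mulVec, nonsing_inv_mul _ hdet, one_mulVec]

theorem finite_eigenvalues (M : Matrix (Fin n) (Fin n) ℝ) :
    {l : ℝ | Module.End.HasEigenvalue (Matrix.toLin' M) l}.Finite :=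
  Module.End.finite_hasEigenvalue _

theorem le_maxEigenvalue {S Sw : Matrix (Fin n) (Fin n) ℝ} (hSw : Sw.PosDef)
    {l : ℝ} {v : Fin n → ℝ} (hv : v ≠ 0) (h : S *ᵥ v = l • Sw *ᵥ v) :
    l ≤ maxEigenvalue (Sw⁻¹ * S) :=
  le_csSup (finite_eigenvalues _).bddAbove
    (Module.End.hasEigenvalue_of_hasEigenvector
      ⟨Module.End.mem_eigenspace_iff.2 (by
        rw [toLin'_apply]; exact (mulVec_eq_smul_mulVec hSw).2 h), hv⟩)

/-- Congruence by a factor `B` of `Sw = Bᴴ B` reduces the claim to `l - B⁻ᴴ S B⁻¹`. An eigenvalue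
`e` of this symmetric matrix makes `l - e` an eigenvalue of `Sw⁻¹ S`, with eigenvector `B⁻¹ v`;
maximality of `l` forces `e ≥ 0`. -/
theorem posSemidef_maxEigenvalue_smul_sub {S Sw : Matrix (Fin n) (Fin n) ℝ} (hS : S.PosSemidef)
    (hSw : Sw.PosDef) : (maxEigenvalue (Sw⁻¹ * S) • Sw - S).PosSemidef := by
  obtain ⟨B, hB, rfl⟩ : ∃ B : Matrix (Fin n) (Fin n) ℝ, IsUnit B ∧ Sw = Bᴴ * B := by
    open scoped MatrixOrder Matrix.Norms.L2Operator in
    exact CStarAlgebra.isStrictlyPositive_iff_eq_star_mul_self.mp hSw.isStrictlyPositive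
  set l := maxEigenvalue ((Bᴴ * B)⁻¹ * S) with hl
  have hBd : IsUnit B.det := (isUnit_iff_isUnit_det _).1 hB
  set M : Matrix (Fin n) (Fin n) ℝ := l • 1 - (B⁻¹)ᴴ * S * B⁻¹ with hM
  have hMh : M.IsHermitian := by
    refine IsHermitian.sub ?_ (isHermitian_conjTranspose_mul_mul _ hS.1)
    exact (isHermitian_one).smul (by simp [IsSelfAdjoint])
  have hMp : M.PosSemidef := by
    refine hMh.posSemidef_iff_eigenvalues_nonneg.2 fun i => ?_
    have hv := hMh.mulVec_eigenvectorBasis i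
    set v : Fin n → ℝ := ⇑(hMh.eigenvectorBasis i) with hvdef
    have hv0 : v ≠ 0 := by
      intro h0
      apply (hMh.eigenvectorBasis.orthonormal.ne_zero i)
      ext j
      exact congrFun h0 j
    set e := hMh.eigenvalues i
    have h1 : ((B⁻¹)ᴴ * S * B⁻¹) *ᵥ v = (l - e) • v := by
      rw [hM, sub_mulVec, smul_mulVec, one_mulVec] at hv
      rw [sub_smul, ← hv]; abel
    have h2 : l - e ≤ l := by
      refine le_maxEigenvalue hSw (v := B⁻¹ *ᵥ v) ?_ ?_
      · intro h0
        apply hv0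
        have := congrArg (B *ᵥ ·) h0
        simpa [mulVec_mulVec, mul_nonsing_inv _ hBd] using this
      · rw [mulVec_mulVec, mulVec_mulVec, mul_assoc, mul_nonsing_inv _ hBd, mul_one,
          ← mulVec_smul, ← h1, mulVec_mulVec, ← mul_assoc, ← mul_assoc, ← conjTranspose_mul,
          nonsing_inv_mul _ hBd]
        simp
    simpa using h2
  have := hMp.conjTranspose_mul_mul_same B
  convert this using 1
  rw [hM, mul_sub, sub_mul, Matrix.mul_smul, smul_mul_assoc, mul_one]
  congr 1
  rw [← mul_assoc, ← mul_assoc, ← conjTranspose_mul, nonsing_inv_mul _ hBd, mul_assoc,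
    nonsing_inv_mul _ hBd]
  simp

theorem specNorm_nonneg (M : Matrix (Fin n) (Fin n) ℝ) : 0 ≤ specNorm M := norm_nonneg _

theorem dotProduct_mulVec_le_specNorm (M : Matrix (Fin n) (Fin n) ℝ)
    (z : EuclideanSpace ℝ (Fin n)) : z.ofLp ⬝ᵥ M *ᵥ z.ofLp ≤ specNorm M * ‖z‖ ^ 2 := by
  calc z.ofLp ⬝ᵥ M *ᵥ z.ofLp = inner ℝ z (toEuclideanCLM (n := Fin n) (𝕜 := ℝ) M z) := by
        rw [inner_toEuclideanCLM]
    _ ≤ ‖z‖ * ‖toEuclideanCLM (n := Fin n) (𝕜 := ℝ) M z‖ := real_inner_le_norm _ _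
    _ ≤ ‖z‖ * (specNorm M * ‖z‖) := by
        gcongr; exact ContinuousLinearMap.le_opNorm _ _
    _ = specNorm M * ‖z‖ ^ 2 := by ring

open scoped MatrixOrder in
-- With `S = Bᴴ B`, the bound `‖B z‖² = zᵀ S z ≤ zᵀ T z` controls the norm of `B`, and `‖Bᴴ B‖ =
-- ‖B‖²`.
theorem specNorm_mono {S T : Matrix (Fin n) (Fin n) ℝ} (hS : S.PosSemidef)
    (hT : (T - S).PosSemidef) : specNorm S ≤ specNorm T := by
  obtain ⟨B, rfl⟩ : ∃ B : Matrix (Fin n) (Fin n) ℝ, S = Bᴴ * B :=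
    CStarAlgebra.nonneg_iff_eq_star_mul_self.mp hS.nonneg
  have hB : specNorm B ≤ √(specNorm T) := by
    refine ContinuousLinearMap.opNorm_le_bound _ (Real.sqrt_nonneg _) fun z => ?_
    rw [← Real.sqrt_sq (norm_nonneg z), ← Real.sqrt_mul (specNorm_nonneg T)]
    refine Real.le_sqrt_of_sq_le (((le_of_eq ?_ : _ ≤ z.ofLp ⬝ᵥ (Bᴴ * B) *ᵥ z.ofLp).trans ?_).trans
      (dotProduct_mulVec_le_specNorm T z))
    · rw [← real_inner_self_eq_norm_sq, EuclideanSpace.inner_eq_star_dotProduct,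
        ← mulVec_mulVec, dotProduct_mulVec, vecMul_conjTranspose]
      simp
    · have := hT.dotProduct_mulVec_nonneg z.ofLp
      rw [sub_mulVec, dotProduct_sub] at this
      simpa using this
  have h1 : specNorm (Bᴴ * B) = specNorm B * specNorm B := by
    rw [specNorm, map_mul, ← star_eq_conjTranspose, map_star]
    exact ContinuousLinearMap.norm_adjoint_comp_self _
  rw [h1, ← Real.mul_self_sqrt (specNorm_nonneg T)]
  exact mul_self_le_mul_self (specNorm_nonneg B) hB

theorem specNorm_smul {c : ℝ} (hc : 0 ≤ c) (S : Matrix (Fin n) (Fin n) ℝ) :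
    specNorm (c • S) = c * specNorm S := by
  rw [specNorm, map_smul, norm_smul, Real.norm_of_nonneg hc, specNorm]

theorem IsDirectionRule.mulVec_eq {S Sw : Matrix (Fin n) (Fin n) ℝ} (hS : S.PosSemidef)
    (hSw : Sw.PosDef) {u : Matrix (Fin n) (Fin n) ℝ → EuclideanSpace ℝ (Fin n)}
    (hu : IsDirectionRule Sw u) :
    S *ᵥ (u S).ofLp = maxEigenvalue (Sw⁻¹ * S) • Sw *ᵥ (u S).ofLp := by
  rw [← mulVec_eq_smul_mulVec hSw]
  simpa using Module.End.mem_eigenspace_iff.1 (hu S hS).2.1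

theorem IsDirectionRule.maxEigenvalue_nonneg {S Sw : Matrix (Fin n) (Fin n) ℝ}
    (hS : S.PosSemidef)
    (hSw : Sw.PosDef) {u : Matrix (Fin n) (Fin n) ℝ → EuclideanSpace ℝ (Fin n)}
    (hu : IsDirectionRule Sw u) : 0 ≤ maxEigenvalue (Sw⁻¹ * S) := by
  have h1 := hS.dotProduct_mulVec_nonneg (u S).ofLp
  have h2 := hSw.dotProduct_mulVec_pos (hu S hS).2.2
  rw [hu.mulVec_eq hS hSw, dotProduct_smul, smul_eq_mul] at h1
  exact nonneg_of_mul_nonneg_left h1 h2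

theorem specNorm_le {S Sw : Matrix (Fin n) (Fin n) ℝ} (hS : S.PosSemidef)
    (hSw : Sw.PosDef) (h0 : 0 ≤ maxEigenvalue (Sw⁻¹ * S)) :
    specNorm S ≤ maxEigenvalue (Sw⁻¹ * S) * specNorm Sw := by
  rw [← specNorm_smul h0]
  exact specNorm_mono hS (posSemidef_maxEigenvalue_smul_sub hS hSw)

/-! ### Deficits and the potential -/

/-- The number of measurements needed along an eigenvector with eigenvalue `l`. -/
def deficit (c l : ℝ) : ℤ := if l = 0 then 0 else max 0 ⌈c - 1 / l⌉

/-- The total number of measurements needed along all eigenvectors. -/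
def potential (c : ℝ) (A : Matrix (Fin n) (Fin n) ℝ) : ℤ := (A.charpoly.roots.map (deficit c)).sum

theorem deficit_nonneg (c l : ℝ) : 0 ≤ deficit c l := by
  unfold deficit
  split_ifs
  · exact le_rfl
  · exact le_max_left _ _

theorem potential_nonneg (c : ℝ) (A : Matrix (Fin n) (Fin n) ℝ) : 0 ≤ potential c A := by
  refine Multiset.sum_nonneg fun x hx => ?_
  obtain ⟨l, -, rfl⟩ := Multiset.mem_map.1 hx
  exact deficit_nonneg c l

theorem measurementBound_eq_potential (S Sw : Matrix (Fin n) (Fin n) ℝ) (ε p : ℝ) :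
    measurementBound S Sw ε p
      = potential (chiSqQuantile n p / ε ^ 2 * specNorm Sw) (Sw⁻¹ * S) := by
  unfold measurementBound potential
  induction (Sw⁻¹ * S).charpoly.roots using Multiset.induction_on with
  | empty => simp
  | cons a s ih =>
    by_cases ha : a = 0
    · simpa [ha, deficit] using ih
    · simpa [ha, deficit] using ih

/-- The reciprocal of `l / (1 + l)` is `1 / l + 1`, so the ceiling drops by 1; a deficit of at least
1 excludes `l = 0` and truncation by the maximum. -/
theorem deficit_div_one_add {c l : ℝ} (hl : 0 ≤ l) (h : 1 ≤ deficit c l) :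
    deficit c (l / (1 + l)) + 1 = deficit c l := by
  have hl0 : l ≠ 0 := by
    rintro rfl
    simp [deficit] at h
  have h1 : l / (1 + l) ≠ 0 := by positivity
  have h2 : c - 1 / (l / (1 + l)) = c - 1 / l - 1 := by
    field_simp
    ring
  have h0 : deficit c l = max 0 ⌈c - 1 / l⌉ := if_neg hl0
  rw [h0] at h ⊢
  have h3 : 1 ≤ ⌈c - 1 / l⌉ := (le_max_iff.1 h).resolve_left (by norm_num)
  rw [deficit, if_neg h1, h2, Int.ceil_sub_one, max_eq_right (by omega), max_eq_right (by omega)]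
  omega

/-! ### The covariance update and its effect on the potential -/

/-- The update of the covariance matrix after one measurement with the vector `a`. -/
def covStep (Sw : Matrix (Fin n) (Fin n) ℝ) (S : Matrix (Fin n) (Fin n) ℝ)
    (a : EuclideanSpace ℝ (Fin n)) : Matrix (Fin n) (Fin n) ℝ :=
  S - (a.ofLp ⬝ᵥ S *ᵥ a.ofLp + a.ofLp ⬝ᵥ Sw *ᵥ a.ofLp)⁻¹ •
    vecMulVec (S *ᵥ a.ofLp) (a.ofLp ᵥ* S)

/-- The gain vector of a measurement with the vector `a`. -/
def gain (Sw : Matrix (Fin n) (Fin n) ℝ) (S : Matrix (Fin n) (Fin n) ℝ)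
    (a : EuclideanSpace ℝ (Fin n)) : Fin n → ℝ :=
  (a.ofLp ⬝ᵥ S *ᵥ a.ofLp + a.ofLp ⬝ᵥ Sw *ᵥ a.ofLp)⁻¹ • S *ᵥ a.ofLp

/-- The error of the posterior mean is multiplied by this matrix in a measurement. -/
def errorFactor (Sw : Matrix (Fin n) (Fin n) ℝ) (S : Matrix (Fin n) (Fin n) ℝ)
    (a : EuclideanSpace ℝ (Fin n)) : Matrix (Fin n) (Fin n) ℝ :=
  1 - vecMulVec (gain Sw S a) a.ofLp

theorem mulVec_eq_vecMul_of_isHermitian {S : Matrix (Fin n) (Fin n) ℝ} (hS : S.IsHermitian)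
    (a : Fin n → ℝ) : a ᵥ* S = S *ᵥ a := by
  rw [← mulVec_transpose, ← conjTranspose_eq_transpose_of_trivial, hS.eq]

/-- The Joseph form of the covariance update. -/
theorem covStep_eq {S : Matrix (Fin n) (Fin n) ℝ} (hS : S.IsHermitian)
    (Sw : Matrix (Fin n) (Fin n) ℝ) (a : EuclideanSpace ℝ (Fin n)) :
    covStep Sw S a = errorFactor Sw S a * S * (errorFactor Sw S a)ᵀ
      + vecMulVec (gain Sw S a) a.ofLp * Sw * (vecMulVec (gain Sw S a) a.ofLp)ᵀ := by
  have hg : gain Sw S a = (a.ofLp ⬝ᵥ S *ᵥ a.ofLp + a.ofLp ⬝ᵥ Sw *ᵥ a.ofLp)⁻¹ • S *ᵥ a.ofLp := rfl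
  have hq := mulVec_eq_vecMul_of_isHermitian hS a.ofLp
  rw [covStep, errorFactor]
  set k := gain Sw S a
  set v := a.ofLp
  set tot := v ⬝ᵥ S *ᵥ v + v ⬝ᵥ Sw *ᵥ v with htot
  have h1 : vecMulVec k v * S * (vecMulVec k v)ᵀ = (v ⬝ᵥ S *ᵥ v) • vecMulVec k k := by
    rw [transpose_vecMulVec, vecMulVec_mul, vecMulVec_mul_vecMulVec, ← dotProduct_mulVec]
    ext i j; simp [vecMulVec_apply]; ring
  have h2 : vecMulVec k v * Sw * (vecMulVec k v)ᵀ = (v ⬝ᵥ Sw *ᵥ v) • vecMulVec k k := by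
    rw [transpose_vecMulVec, vecMulVec_mul, vecMulVec_mul_vecMulVec, ← dotProduct_mulVec]
    ext i j; simp [vecMulVec_apply]; ring
  have h3 : vecMulVec k v * S = vecMulVec k (S *ᵥ v) := by rw [vecMulVec_mul, hq]
  have h4 : S * (vecMulVec k v)ᵀ = vecMulVec (S *ᵥ v) k := by
    rw [transpose_vecMulVec, mul_vecMulVec]
  have h5 : tot • vecMulVec k k = vecMulVec k (S *ᵥ v) := by
    rw [hg]
    ext i j
    simp only [Matrix.smul_apply, vecMulVec_apply, Pi.smul_apply, smul_eq_mul]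
    -- If `tot = 0`, the convention `0⁻¹ = 0` makes the gain vanish, so no positivity of `Sw` is
    -- needed.
    by_cases h0 : tot = 0
    · simp [h0]
    · field_simp
  have h6 : tot⁻¹ • vecMulVec (S *ᵥ v) (v ᵥ* S) = vecMulVec (S *ᵥ v) k := by
    rw [hq, hg, vecMulVec_smul]
  rw [transpose_sub, transpose_one, sub_mul, sub_mul, mul_sub, mul_sub, mul_one, mul_one, one_mul,
    h4, h1, h2, h3, h6, ← h5, htot, add_smul]
  abel

theorem PosSemidef.covStep {S Sw : Matrix (Fin n) (Fin n) ℝ} (hS : S.PosSemidef)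
    (hSw : Sw.PosSemidef) (a : EuclideanSpace ℝ (Fin n)) :
    (InfoGreedy.covStep Sw S a).PosSemidef := by
  rw [covStep_eq hS.1]
  simp_rw [← conjTranspose_eq_transpose_of_trivial]
  exact (hS.mul_mul_conjTranspose_same _).add (hSw.mul_mul_conjTranspose_same _)

section Eigenvector
variable {S Sw : Matrix (Fin n) (Fin n) ℝ} {a : EuclideanSpace ℝ (Fin n)} {l : ℝ}

theorem covStep_of_eigenvector (hS : S.PosSemidef)
    (h : S *ᵥ a.ofLp = l • Sw *ᵥ a.ofLp) :
    covStep Sw S a = S - (l ^ 2 / ((1 + l) * (a.ofLp ⬝ᵥ Sw *ᵥ a.ofLp))) •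
      vecMulVec (Sw *ᵥ a.ofLp) (Sw *ᵥ a.ofLp) := by
  rw [covStep, mulVec_eq_vecMul_of_isHermitian hS.1, h, dotProduct_smul, smul_vecMulVec,
    vecMulVec_smul, smul_smul, smul_smul]
  congr 2
  rw [smul_eq_mul, show l * (a.ofLp ⬝ᵥ Sw *ᵥ a.ofLp) + a.ofLp ⬝ᵥ Sw *ᵥ a.ofLp
    = (1 + l) * (a.ofLp ⬝ᵥ Sw *ᵥ a.ofLp) by ring]
  ring

theorem covStep_mulVec_of_eigenvector (hS : S.PosSemidef) (hSw : Sw.PosDef) (ha : a.ofLp ≠ 0)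
    (hl : 0 ≤ l) (h : S *ᵥ a.ofLp = l • Sw *ᵥ a.ofLp) :
    covStep Sw S a *ᵥ a.ofLp = (l / (1 + l)) • Sw *ᵥ a.ofLp := by
  have hc : 0 < a.ofLp ⬝ᵥ Sw *ᵥ a.ofLp := by simpa using hSw.dotProduct_mulVec_pos ha
  have hc' : (Sw *ᵥ a.ofLp) ⬝ᵥ a.ofLp = a.ofLp ⬝ᵥ Sw *ᵥ a.ofLp := dotProduct_comm _ _
  rw [covStep_of_eigenvector hS h, sub_mulVec, h, smul_mulVec, vecMulVec_mulVec, hc']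
  ext i
  simp only [Pi.sub_apply, Pi.smul_apply, smul_eq_mul, MulOpposite.smul_eq_mul_unop,
    MulOpposite.unop_op]
  field_simp
  ring

/-- After multiplication by `Sw⁻¹` the update is a rank-one perturbation along `a`, with the
functional `Sw a / (aᵀ Sw a)` normalized to 1 on `a`. It trades one root `l` for `l / (1 + l)` and
keeps all others with multiplicity. -/
theorem potential_covStep (hS : S.PosSemidef) (hSw : Sw.PosDef) (ha : a.ofLp ≠ 0)
    (hl : 0 ≤ l) (h : S *ᵥ a.ofLp = l • Sw *ᵥ a.ofLp) {c : ℝ} (hd : 1 ≤ deficit c l) :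
    potential c (Sw⁻¹ * covStep Sw S a) + 1 = potential c (Sw⁻¹ * S) := by
  have hc : 0 < a.ofLp ⬝ᵥ Sw *ᵥ a.ofLp := by simpa using hSw.dotProduct_mulVec_pos ha
  have hdet : IsUnit Sw.det := (isUnit_iff_isUnit_det _).1 hSw.isUnit
  have hA : Sw⁻¹ * covStep Sw S a = Sw⁻¹ * S - (l - l / (1 + l)) •
      vecMulVec a.ofLp ((a.ofLp ⬝ᵥ Sw *ᵥ a.ofLp)⁻¹ • Sw *ᵥ a.ofLp) := by
    rw [covStep_of_eigenvector hS h, mul_sub, Matrix.mul_smul, mul_vecMulVec, mulVec_mulVec,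
      nonsing_inv_mul _ hdet, one_mulVec, vecMulVec_smul, smul_smul]
    congr 2
    field_simp
    ring
  have hr := cons_roots_charpoly_sub_smul_vecMulVec (Sw⁻¹ * S) a.ofLp
    ((a.ofLp ⬝ᵥ Sw *ᵥ a.ofLp)⁻¹ • Sw *ᵥ a.ofLp) l (l - l / (1 + l))
    ((mulVec_eq_smul_mulVec hSw).2 h) (by
      rw [smul_dotProduct, dotProduct_comm (Sw *ᵥ _), smul_eq_mul, inv_mul_cancel₀ hc.ne'])
  rw [← hA] at hr
  have hs : deficit c l + potential c (Sw⁻¹ * covStep Sw S a)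
      = deficit c (l / (1 + l)) + potential c (Sw⁻¹ * S) := by
    rw [potential, potential, ← Multiset.sum_cons, ← Multiset.map_cons, hr, sub_sub_cancel,
      Multiset.map_cons, Multiset.sum_cons]
  have := deficit_div_one_add hl hd
  omega

/-- The vector `a` stays a generalized eigenvector after each update, so a whole pass can reuse it
while its deficit lasts; this is why `l` varies in the induction. -/
theorem potential_foldl_replicate (hS : S.PosSemidef) (hSw : Sw.PosDef) (ha : a.ofLp ≠ 0)
    (hl : 0 ≤ l) (h : S *ᵥ a.ofLp = l • Sw *ᵥ a.ofLp) {c : ℝ} {j : ℕ} (hj : (j : ℤ) ≤ deficit c l) :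
    ((List.replicate j a).foldl (covStep Sw) S).PosSemidef ∧
      potential c (Sw⁻¹ * (List.replicate j a).foldl (covStep Sw) S) + j
        = potential c (Sw⁻¹ * S) := by
  induction j generalizing S l with
  | zero => simpa using hS
  | succ j ih =>
    push_cast at hj
    have hd : 1 ≤ deficit c l := by omega
    have hstep := deficit_div_one_add hl hd
    obtain ⟨h1, h2⟩ := ih (PosSemidef.covStep hS hSw.posSemidef a) (l := l / (1 + l))
      (by positivity) (covStep_mulVec_of_eigenvector hS hSw ha hl h) (by omega)
    have h3 := potential_covStep hS hSw ha hl h hd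
    rw [List.replicate_succ, List.foldl_cons]
    refine ⟨h1, ?_⟩
    push_cast
    omega

end Eigenvector

/-! ### Termination and the number of measurements -/

theorem foldl_measureOnce_cov (Sw : Matrix (Fin n) (Fin n) ℝ)
    (meas : ℕ → EuclideanSpace ℝ (Fin n) → ℝ) (as : List (EuclideanSpace ℝ (Fin n)))
    (s : State n) :
    (as.foldl (fun s a => measureOnce Sw meas a s) s).cov = as.foldl (covStep Sw) s.cov := by
  induction as generalizing s with
  | nil => rfl
  | cons a as ih => exact ih _

theorem foldl_measureOnce_count (Sw : Matrix (Fin n) (Fin n) ℝ)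
    (meas : ℕ → EuclideanSpace ℝ (Fin n) → ℝ) (as : List (EuclideanSpace ℝ (Fin n)))
    (s : State n) :
    (as.foldl (fun s a => measureOnce Sw meas a s) s).count = s.count + as.length := by
  induction as generalizing s with
  | nil => rfl
  | cons a as ih =>
    rw [List.foldl_cons, ih, List.length_cons, measureOnce]
    simp only
    omega

theorem loopBody_eq_foldl (Sw : Matrix (Fin n) (Fin n) ℝ)
    (u : Matrix (Fin n) (Fin n) ℝ → EuclideanSpace ℝ (Fin n))
    (r : Matrix (Fin n) (Fin n) ℝ → ℕ)
    (meas : ℕ → EuclideanSpace ℝ (Fin n) → ℝ) (s : State n) :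
    loopBody Sw u r meas s
      = (List.replicate (r s.cov) (u s.cov)).foldl (fun s a => measureOnce Sw meas a s) s := by
  unfold loopBody
  generalize u s.cov = a
  induction r s.cov generalizing s with
  | zero => rfl
  | succ k ih => rw [Function.iterate_succ_apply, ih, List.replicate_succ, List.foldl_cons]

theorem ceil_power (S Sw : Matrix (Fin n) (Fin n) ℝ) (ε p : ℝ) :
    ((⌈power Sw ε p S⌉₊ : ℕ) : ℤ)
      = deficit (chiSqQuantile n p / ε ^ 2 * specNorm Sw) (maxEigenvalue (Sw⁻¹ * S)) := by
  unfold power deficit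
  split_ifs with h
  · simp
  · rw [Int.natCast_ceil_eq_ceil (le_max_left _ _), Int.ceil_mono.map_max, Int.ceil_zero]

theorem specNorm_le_of_deficit_eq_zero {S Sw : Matrix (Fin n) (Fin n) ℝ} (hS : S.PosSemidef)
    (hSw : Sw.PosDef) (h0 : 0 ≤ maxEigenvalue (Sw⁻¹ * S)) {q ε : ℝ} (hq : 0 < q) (hε : 0 < ε)
    (hd : deficit (q / ε ^ 2 * specNorm Sw) (maxEigenvalue (Sw⁻¹ * S)) = 0) :
    specNorm S ≤ ε ^ 2 / q := by
  refine (specNorm_le hS hSw h0).trans ?_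
  set l := maxEigenvalue (Sw⁻¹ * S)
  by_cases hl : l = 0
  · rw [hl, zero_mul]; positivity
  · rw [deficit, if_neg hl] at hd
    have h1 : ⌈q / ε ^ 2 * specNorm Sw - 1 / l⌉ ≤ 0 := by
      rw [← hd]; exact le_max_right _ _
    rw [Int.ceil_le] at h1
    have hl' : 0 < l := lt_of_le_of_ne h0 (Ne.symm hl)
    have h2 : q / ε ^ 2 * specNorm Sw ≤ 1 / l := by simpa using h1
    rw [le_div_iff₀ hl'] at h2
    rw [le_div_iff₀ hq]
    calc l * specNorm Sw * q = (q / ε ^ 2 * specNorm Sw * l) * ε ^ 2 := by field_simp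
      _ ≤ 1 * ε ^ 2 := by gcongr
      _ = ε ^ 2 := one_mul _

/-- The directions of the measurements do not depend on the outcomes, and their number is at most
the potential of the initial covariance matrix. -/
theorem exists_directions {Sw : Matrix (Fin n) (Fin n) ℝ} (hSw : Sw.PosDef) {ε p : ℝ} (hε : 0 < ε)
    (hq : 0 < chiSqQuantile n p) {u : Matrix (Fin n) (Fin n) ℝ → EuclideanSpace ℝ (Fin n)}
    (hu : IsDirectionRule Sw u) {r : Matrix (Fin n) (Fin n) ℝ → ℕ}
    (hr : IsRepetitionRule Sw ε p r) (S : Matrix (Fin n) (Fin n) ℝ) (hS : S.PosSemidef) :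
    ∃ as : List (EuclideanSpace ℝ (Fin n)),
      (as.length : ℤ) ≤ potential (chiSqQuantile n p / ε ^ 2 * specNorm Sw) (Sw⁻¹ * S) ∧
      specNorm (as.foldl (covStep Sw) S) ≤ ε ^ 2 / chiSqQuantile n p ∧
      ∀ meas m k, RepeatUntil (loopBody Sw u r meas)
        (fun s => specNorm s.cov ≤ ε ^ 2 / chiSqQuantile n p) ⟨m, S, k⟩
        (as.foldl (fun s a => measureOnce Sw meas a s) ⟨m, S, k⟩) := by
  set c := chiSqQuantile n p / ε ^ 2 * specNorm Sw with hc
  induction hN : (potential c (Sw⁻¹ * S)).toNat using Nat.strong_induction_on generalizing S with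
  | _ N ih =>
    have hl := hu.maxEigenvalue_nonneg hS hSw
    have hceil : _ = deficit c _ := ceil_power S Sw ε p
    have hrS := hr S hS
    obtain ⟨hT, hpot⟩ := potential_foldl_replicate (a := u S) (j := r S) (c := c) hS hSw
      (hu S hS).2.2 hl (hu.mulVec_eq hS hSw) (by rw [← hceil]; exact_mod_cast hrS.2)
    set T := (List.replicate (r S) (u S)).foldl (covStep Sw) S with hTdef
    have hbody (meas m k) : (loopBody Sw u r meas ⟨m, S, k⟩).cov = T := by
      rw [loopBody_eq_foldl, foldl_measureOnce_cov]
    by_cases hcrit : specNorm T ≤ ε ^ 2 / chiSqQuantile n p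
    · refine ⟨List.replicate (r S) (u S), ?_, hcrit, fun meas m k => ?_⟩
      · have := potential_nonneg c (Sw⁻¹ * T)
        rw [List.length_replicate]
        omega
      · have := RepeatUntil.halt (body := loopBody Sw u r meas)
          (crit := fun s => specNorm s.cov ≤ ε ^ 2 / chiSqQuantile n p) ⟨m, S, k⟩
          (by rwa [hbody])
        rwa [loopBody_eq_foldl] at this
    -- A pass without measurements has deficit zero at the largest eigenvalue, so the stopping
    -- criterion would already hold. Hence a pass that does not stop strictly lowers the potential.
    · have hr1 : 1 ≤ r S := by
        by_contra h
        have h0 : r S = 0 := by omega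
        apply hcrit
        have hTS : T = S := by rw [hTdef, h0]; rfl
        rw [hTS]
        refine specNorm_le_of_deficit_eq_zero hS hSw hl hq hε ?_
        rw [← hc, ← hceil]
        omega
      have hpT := potential_nonneg c (Sw⁻¹ * T)
      obtain ⟨as, h1, h2, h3⟩ := ih _ (by omega) T hT rfl
      refine ⟨List.replicate (r S) (u S) ++ as, ?_, ?_, fun meas m k => ?_⟩
      · rw [List.length_append, List.length_replicate]
        push_cast
        omega
      · rwa [List.foldl_append]
      · refine RepeatUntil.again _ _ (by rwa [hbody]) ?_
        rw [List.foldl_append, ← loopBody_eq_foldl Sw u r meas ⟨m, S, k⟩]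
        have h4 := h3 meas (loopBody Sw u r meas ⟨m, S, k⟩).mean
          (loopBody Sw u r meas ⟨m, S, k⟩).count
        rwa [← hbody meas m k] at h4

/-! ### The law of the estimation error -/

theorem inner_toEuclideanCLM_right (C : Matrix (Fin n) (Fin n) ℝ)
    (x t : EuclideanSpace ℝ (Fin n)) :
    inner ℝ (toEuclideanCLM (n := Fin n) (𝕜 := ℝ) C x) t
      = inner ℝ x (toEuclideanCLM (n := Fin n) (𝕜 := ℝ) Cᵀ t) := by
  rw [real_inner_comm, inner_toEuclideanCLM, inner_toEuclideanCLM, dotProduct_mulVec,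
    ← mulVec_transpose, dotProduct_comm]

/-- The image of a Gaussian vector under an affine map that sends its mean to `0`. -/
theorem hasLaw_toEuclideanCLM_sub {Ω : Type*} [MeasurableSpace Ω] {P : Measure Ω}
    {X : Ω → EuclideanSpace ℝ (Fin n)} {m : EuclideanSpace ℝ (Fin n)}
    {S : Matrix (Fin n) (Fin n) ℝ} (hS : S.PosSemidef) (hX : HasLaw X (multivariateGaussian m S) P)
    (C : Matrix (Fin n) (Fin n) ℝ) :
    HasLaw (fun ω => toEuclideanCLM (n := Fin n) (𝕜 := ℝ) C (X ω - m))
      (multivariateGaussian 0 (C * S * Cᵀ)) P := by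
  refine HasLaw.fun_comp (μ := multivariateGaussian m S)
    (Y := fun z => toEuclideanCLM (n := Fin n) (𝕜 := ℝ) C (z - m)) ⟨by fun_prop, ?_⟩ hX
  have hC : (C * S * Cᵀ).PosSemidef := by
    rw [← conjTranspose_eq_transpose_of_trivial]; exact hS.mul_mul_conjTranspose_same C
  have : IsProbabilityMeasure ((multivariateGaussian m S).map
      (fun z => toEuclideanCLM (n := Fin n) (𝕜 := ℝ) C (z - m))) :=
    Measure.isProbabilityMeasure_map (by fun_prop)
  refine Measure.ext_of_charFun ?_
  ext t
  have h1 (z : EuclideanSpace ℝ (Fin n)) :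
      Complex.exp ((inner ℝ (toEuclideanCLM (n := Fin n) (𝕜 := ℝ) C (z - m)) t : ℝ) * Complex.I)
        = Complex.exp ((inner ℝ z (toEuclideanCLM (n := Fin n) (𝕜 := ℝ) Cᵀ t) : ℝ) * Complex.I)
          * Complex.exp (-((inner ℝ m (toEuclideanCLM (n := Fin n) (𝕜 := ℝ) Cᵀ t) : ℝ) *
            Complex.I)) := by
    rw [← Complex.exp_add, inner_toEuclideanCLM_right, inner_sub_left]
    push_cast
    ring_nf
  rw [charFun_apply, integral_map (by fun_prop) (by fun_prop)]
  simp_rw [h1]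
  rw [integral_mul_const, ← charFun_apply, charFun_multivariateGaussian hS,
    charFun_multivariateGaussian hC, ← Complex.exp_add, inner_zero_right, real_inner_comm m]
  congr 1
  have h2 : t.ofLp ⬝ᵥ (C * S * Cᵀ) *ᵥ t.ofLp
      = (Cᵀ *ᵥ t.ofLp) ⬝ᵥ S *ᵥ (Cᵀ *ᵥ t.ofLp) := by
    rw [← mulVec_mulVec, ← mulVec_mulVec, dotProduct_mulVec, ← mulVec_transpose]
  rw [h2, ofLp_toEuclideanCLM]
  push_cast
  ring

/-- Characteristic functions are used because the covariances may be singular, so that densities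
need not exist. -/
theorem hasLaw_add {Ω : Type*} [MeasurableSpace Ω] {P : Measure Ω} [IsProbabilityMeasure P]
    {X Y : Ω → EuclideanSpace ℝ (Fin n)} {S T : Matrix (Fin n) (Fin n) ℝ} (hS : S.PosSemidef)
    (hT : T.PosSemidef) (hX : HasLaw X (multivariateGaussian 0 S) P)
    (hY : HasLaw Y (multivariateGaussian 0 T) P) (hXY : IndepFun X Y P) :
    HasLaw (X + Y) (multivariateGaussian 0 (S + T)) P := by
  refine ⟨hX.aemeasurable.add hY.aemeasurable, ?_⟩
  have : IsProbabilityMeasure (P.map (X + Y)) :=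
    Measure.isProbabilityMeasure_map (hX.aemeasurable.add hY.aemeasurable)
  refine Measure.ext_of_charFun ?_
  ext t
  rw [hXY.charFun_map_add_eq_mul hX.aemeasurable hY.aemeasurable, Pi.mul_apply, hX.map_eq,
    hY.map_eq, charFun_multivariateGaussian hS, charFun_multivariateGaussian hT,
    charFun_multivariateGaussian (hS.add hT), ← Complex.exp_add, add_mulVec, dotProduct_add,
    inner_zero_right]
  congr 1
  push_cast
  ring

theorem multivariateGaussian_zero_zero :
    multivariateGaussian (0 : EuclideanSpace ℝ (Fin n)) 0 = Measure.dirac 0 := by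
  simp [multivariateGaussian]

theorem posSemidef_noise {Sw : Matrix (Fin n) (Fin n) ℝ} (hSw : Sw.PosSemidef)
    (C : ℕ → Matrix (Fin n) (Fin n) ℝ) (t : ℕ) :
    (∑ i ∈ Finset.range t, C i * Sw * (C i)ᵀ).PosSemidef :=
  Matrix.posSemidef_sum _ fun i _ => by
    rw [← conjTranspose_eq_transpose_of_trivial]; exact hSw.mul_mul_conjTranspose_same _

theorem hasLaw_sum {Ω : Type*} [MeasurableSpace Ω] {P : Measure Ω} [IsProbabilityMeasure P]
    {w : ℕ → Ω → EuclideanSpace ℝ (Fin n)} {Sw : Matrix (Fin n) (Fin n) ℝ} (hSw : Sw.PosSemidef)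
    (hw : ∀ t, HasLaw (w t) (multivariateGaussian 0 Sw) P) (hw_indep : iIndepFun w P)
    (C : ℕ → Matrix (Fin n) (Fin n) ℝ) (t : ℕ) :
    HasLaw (∑ i ∈ Finset.range t, fun ω => toEuclideanCLM (n := Fin n) (𝕜 := ℝ) (C i) (w i ω))
      (multivariateGaussian 0 (∑ i ∈ Finset.range t, C i * Sw * (C i)ᵀ)) P := by
  have hlaw (i : ℕ) : HasLaw (fun ω => toEuclideanCLM (n := Fin n) (𝕜 := ℝ) (C i) (w i ω))
      (multivariateGaussian 0 (C i * Sw * (C i)ᵀ)) P := by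
    simpa using hasLaw_toEuclideanCLM_sub hSw (hw i) (C i)
  induction t with
  | zero =>
    rw [Finset.sum_range_zero, Finset.sum_range_zero, multivariateGaussian_zero_zero]
    refine ⟨aemeasurable_const, ?_⟩
    exact (Measure.map_const _ _).trans (by simp)
  | succ t ih =>
    rw [Finset.sum_range_succ, Finset.sum_range_succ]
    refine hasLaw_add (posSemidef_noise hSw C t) ?_ ih (hlaw t) ?_
    · rw [← conjTranspose_eq_transpose_of_trivial]; exact hSw.mul_mul_conjTranspose_same _
    · have hind : iIndepFun (fun i ω => toEuclideanCLM (n := Fin n) (𝕜 := ℝ) (C i) (w i ω)) P :=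
        hw_indep.comp (fun i => ⇑(toEuclideanCLM (n := Fin n) (𝕜 := ℝ) (C i)))
          (fun i => (toEuclideanCLM (n := Fin n) (𝕜 := ℝ) (C i)).continuous.measurable)
      exact hind.indepFun_sum_range_succ₀ (fun i => (hlaw i).aemeasurable) t

/-- The error of the posterior mean is a linear function of the signal and of the noises, with the
posterior covariance matrix as covariance. -/
theorem exists_error_eq {S Sw : Matrix (Fin n) (Fin n) ℝ} (hS : S.PosSemidef)
    (hSw : Sw.PosSemidef) (μ : EuclideanSpace ℝ (Fin n)) (as : List (EuclideanSpace ℝ (Fin n))) :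
    ∃ (A : Matrix (Fin n) (Fin n) ℝ) (C : ℕ → Matrix (Fin n) (Fin n) ℝ),
      as.foldl (covStep Sw) S
        = A * S * Aᵀ + ∑ i ∈ Finset.range as.length, C i * Sw * (C i)ᵀ ∧
      ∀ (x : EuclideanSpace ℝ (Fin n)) (w : ℕ → EuclideanSpace ℝ (Fin n)),
        x - (as.foldl (fun s a => measureOnce Sw (fun t a => inner ℝ a (x + w t)) a s)
          ⟨μ, S, 0⟩).mean
        = toEuclideanCLM (n := Fin n) (𝕜 := ℝ) A (x - μ)
          + ∑ i ∈ Finset.range as.length, toEuclideanCLM (n := Fin n) (𝕜 := ℝ) (C i) (w i) := by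
  induction as using List.reverseRecOn with
  | nil => exact ⟨1, 0, by simp, fun x w => by simp⟩
  | append_singleton as a ih =>
    obtain ⟨A, C, hcov, herr⟩ := ih
    set T := as.foldl (covStep Sw) S with hT
    have hTp : T.PosSemidef := by
      rw [hcov]
      refine .add ?_ (posSemidef_noise hSw C _)
      rw [← conjTranspose_eq_transpose_of_trivial]; exact hS.mul_mul_conjTranspose_same A
    set B := errorFactor Sw T a with hB
    set K := vecMulVec (gain Sw T a) a.ofLp with hK
    have hlt : ∀ i ∈ Finset.range as.length, i ≠ as.length := fun i hi =>
      (Finset.mem_range.1 hi).ne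
    -- With `e` the old error, the new one is `B e - K w`, where `w` is the fresh noise: old
    -- coefficients are multiplied by `B`, and the new one is `-K`.
    obtain ⟨D, hDlast, hD⟩ : ∃ D : ℕ → Matrix (Fin n) (Fin n) ℝ, D as.length = -K ∧
        ∀ i ∈ Finset.range as.length, D i = B * C i :=
      ⟨fun i => if i = as.length then -K else B * C i, if_pos rfl, fun i hi => if_neg (hlt i hi)⟩
    refine ⟨B * A, D, ?_, fun x w => ?_⟩
    · rw [List.foldl_append, List.length_append, List.length_singleton, Finset.sum_range_succ,
        hDlast, List.foldl_cons, List.foldl_nil, ← hT, covStep_eq hTp.1, ← hB, ← hK, hcov,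
        Finset.sum_congr (f := fun i => D i * Sw * (D i)ᵀ) rfl fun i hi => by rw [hD i hi]]
      simp only [transpose_mul, transpose_neg, mul_add, add_mul, Finset.mul_sum, Finset.sum_mul,
        mul_assoc, neg_mul, mul_neg, neg_neg, add_assoc]
    · rw [List.foldl_append, List.length_append, List.length_singleton, Finset.sum_range_succ,
        hDlast, List.foldl_cons, List.foldl_nil,
        Finset.sum_congr (g := fun i => toEuclideanCLM (n := Fin n) (𝕜 := ℝ) (B * C i) (w i)) rfl
          fun i hi => by rw [hD i hi]]
      set meas : ℕ → EuclideanSpace ℝ (Fin n) → ℝ := fun t a => inner ℝ a (x + w t)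
      -- The counter equals `as.length`, so the added measurement reads a noise that has not been
      -- used before.
      have hcount := foldl_measureOnce_count Sw meas as ⟨μ, S, 0⟩
      have hc := foldl_measureOnce_cov Sw meas as ⟨μ, S, 0⟩
      have he := herr x w
      set s := as.foldl (fun s a => measureOnce Sw meas a s) ⟨μ, S, 0⟩
      have hKv (v : EuclideanSpace ℝ (Fin n)) : toEuclideanCLM (n := Fin n) (𝕜 := ℝ) K v
          = inner ℝ a v • WithLp.toLp 2 (gain Sw T a) := by
        ext i
        simp [hK, vecMulVec_mulVec, EuclideanSpace.inner_eq_star_dotProduct, dotProduct_comm,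
          mul_comm]
      have hmean : (measureOnce Sw meas a s).mean = s.mean
          + toEuclideanCLM (n := Fin n) (𝕜 := ℝ) K (x - s.mean)
          + toEuclideanCLM (n := Fin n) (𝕜 := ℝ) K (w as.length) := by
        rw [hKv, hKv, add_assoc, ← add_smul, ← inner_add_right]
        simp only [measureOnce, hc, hcount, zero_add, gain, meas, ← hT]
        rw [WithLp.toLp_smul, smul_smul, ← inner_sub_right]
        congr 2
        rw [mul_comm]
        congr 2
        abel
      have hsplit : x - (measureOnce Sw meas a s).mean
          = toEuclideanCLM (n := Fin n) (𝕜 := ℝ) B (x - s.mean)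
            - toEuclideanCLM (n := Fin n) (𝕜 := ℝ) K (w as.length) := by
        rw [hmean, hB, errorFactor, ← hK, map_sub (toEuclideanCLM (n := Fin n) (𝕜 := ℝ)), map_one]
        simp only [_root_.sub_apply, one_apply_eq_self]
        abel
      rw [hsplit, he]
      simp only [map_add, map_sum, map_mul, map_neg, mul_apply_eq_comp,
        _root_.neg_apply]
      abel

theorem hasLaw_error {Ω : Type*} [MeasurableSpace Ω] {P : Measure Ω} [IsProbabilityMeasure P]
    {μ : EuclideanSpace ℝ (Fin n)} {S Sw : Matrix (Fin n) (Fin n) ℝ} (hS : S.PosSemidef)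
    (hSw : Sw.PosSemidef) {x : Ω → EuclideanSpace ℝ (Fin n)}
    {w : ℕ → Ω → EuclideanSpace ℝ (Fin n)} (hx : HasLaw x (multivariateGaussian μ S) P)
    (hw : ∀ t, HasLaw (w t) (multivariateGaussian 0 Sw) P) (hw_indep : iIndepFun w P)
    (hxw_indep : IndepFun x (fun ω t => w t ω) P) (as : List (EuclideanSpace ℝ (Fin n))) :
    HasLaw (fun ω => x ω - (as.foldl (fun s a => measureOnce Sw
        (fun t a => inner ℝ a (x ω + w t ω)) a s) ⟨μ, S, 0⟩).mean)
      (multivariateGaussian 0 (as.foldl (covStep Sw) S)) P := by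
  obtain ⟨A, C, hcov, herr⟩ := exists_error_eq hS hSw μ as
  have hfun := funext fun ω => herr (x ω) (fun t => w t ω)
  rw [hfun, hcov]
  have hind : IndepFun (fun ω => toEuclideanCLM (n := Fin n) (𝕜 := ℝ) A (x ω - μ))
      (∑ i ∈ Finset.range as.length,
        fun ω => toEuclideanCLM (n := Fin n) (𝕜 := ℝ) (C i) (w i ω)) P := by
    have := hxw_indep.comp (φ := fun z => toEuclideanCLM (n := Fin n) (𝕜 := ℝ) A (z - μ))
      (ψ := fun v => ∑ i ∈ Finset.range as.length,
        toEuclideanCLM (n := Fin n) (𝕜 := ℝ) (C i) (v i)) (by fun_prop) (by fun_prop)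
    convert this using 1 <;> exact funext fun ω => by simp
  have := hasLaw_add (by
    rw [← conjTranspose_eq_transpose_of_trivial]; exact hS.mul_mul_conjTranspose_same A)
    (posSemidef_noise hSw C as.length) (hasLaw_toEuclideanCLM_sub hS hx A)
    (hasLaw_sum hSw hw hw_indep C as.length) hind
  convert this using 1
  funext ω
  simp

/-! ### The chi-squared quantile and Gaussian concentration -/

instance isProbabilityMeasure_chiSq : IsProbabilityMeasure (chiSq n) :=
  Measure.isProbabilityMeasure_map (Measurable.aemeasurable (by fun_prop))

/-- By Fubini it suffices to fix all coordinates but the first, which then has at most two possible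
values. For `n = 0` the law is a point mass at 0, whence `1 ≤ n`. -/
theorem chiSq_singleton (hn : 1 ≤ n) (c : ℝ) : chiSq n {c} = 0 := by
  obtain ⟨m, rfl⟩ : ∃ m, n = m + 1 := ⟨n - 1, by omega⟩
  have hmp := (measurePreserving_piFinSuccAbove (fun _ : Fin (m + 1) => gaussianReal 0 1) 0).symm
  rw [chiSq, ← hmp.map_eq, Measure.map_map (by fun_prop) (MeasurableEquiv.measurable _),
    Measure.map_apply (by fun_prop) (measurableSet_singleton c)]
  have hset : MeasurableSet ((fun q : ℝ × (Fin m → ℝ) => q.1 ^ 2 + ∑ i, q.2 i ^ 2) ⁻¹' {c}) :=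
    measurableSet_preimage (by fun_prop) (measurableSet_singleton c)
  have hfun : (fun z : Fin (m + 1) → ℝ => ∑ i, z i ^ 2) ∘
      (MeasurableEquiv.piFinSuccAbove (fun _ : Fin (m + 1) => ℝ) 0).symm
      = fun q : ℝ × (Fin m → ℝ) => q.1 ^ 2 + ∑ i, q.2 i ^ 2 := by
    ext q
    simp [Fin.sum_univ_succ, MeasurableEquiv.piFinSuccAbove]
  rw [hfun]
  refine (Measure.prod_apply_symm hset).trans ?_
  simp only [Set.preimage_preimage]
  refine (lintegral_congr fun b => ?_).trans lintegral_zero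
  have hfin : ((fun a : ℝ => a ^ 2 + ∑ i, b i ^ 2) ⁻¹' {c}).Finite := by
    refine (Set.toFinite {√(c - ∑ i, b i ^ 2), -√(c - ∑ i, b i ^ 2)}).subset fun a ha => ?_
    have h1 : a ^ 2 + ∑ i, b i ^ 2 = c := ha
    have h2 : c - ∑ i, b i ^ 2 = a ^ 2 := by linarith
    rw [h2, Real.sqrt_sq_eq_abs]
    rcases abs_choice a with h | h <;> simp [h]
  have : NullSingletonClass (gaussianReal 0 1) := nullSingletonClass_gaussianReal one_ne_zero
  exact hfin.measure_zero _

/-- Right-continuity of the distribution function shows that the infimum defining a quantile is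
attained. -/
theorem le_cdf_of_isGLB (ν : Measure ℝ) (p : ℝ) {t : ℝ} (ht : IsGLB {t : ℝ | p ≤ cdf ν t} t) :
    p ≤ cdf ν t := by
  have hcont : Filter.Tendsto (cdf ν) (nhdsWithin t (Set.Ioi t)) (nhds (cdf ν t)) :=
    ((cdf ν).right_continuous t).mono Set.Ioi_subset_Ici_self
  refine ge_of_tendsto hcont ?_
  filter_upwards [self_mem_nhdsWithin] with s hs
  obtain ⟨q, hq, hqs⟩ := (isGLB_lt_iff ht).1 hs
  exact le_trans hq (monotone_cdf ν hqs.le)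

theorem chiSqQuantile_pos_and_le_cdf (hn : 1 ≤ n) {p : ℝ} (hp0 : 0 < p) (hp1 : p < 1) :
    0 < chiSqQuantile n p ∧ p ≤ cdf (chiSq n) (chiSqQuantile n p) := by
  have hcdf0 : cdf (chiSq n) 0 = 0 := by
    rw [cdf_eq_real, ← Set.Iio_union_right, measureReal_eq_zero_iff, measure_union_null_iff]
    refine ⟨?_, chiSq_singleton hn 0⟩
    rw [chiSq, Measure.map_apply (by fun_prop) measurableSet_Iio]
    have : (fun z : Fin n → ℝ => ∑ i, z i ^ 2) ⁻¹' Set.Iio 0 = ∅ := by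
      ext z
      simpa using Finset.sum_nonneg fun i _ => sq_nonneg (z i)
    rw [this, measure_empty]
  have hne : {t : ℝ | p ≤ cdf (chiSq n) t}.Nonempty :=
    ((tendsto_cdf_atTop (chiSq n)).eventually (eventually_ge_nhds hp1)).exists
  have hbdd : BddBelow {t : ℝ | p ≤ cdf (chiSq n) t} := by
    refine ⟨0, fun t ht => ?_⟩
    by_contra h
    have h1 : p ≤ cdf (chiSq n) t := ht
    have := monotone_cdf (chiSq n) (not_le.1 h).le
    linarith
  have hle := le_cdf_of_isGLB (chiSq n) p (isGLB_csInf hne hbdd)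
  refine ⟨?_, hle⟩
  by_contra h
  have := monotone_cdf (chiSq n) (not_lt.1 h)
  exact absurd (hle.trans (this.trans_eq hcdf0)) (not_le.2 hp0)

theorem stdGaussian_real_norm_sq_lt (q : ℝ) :
    (stdGaussian (EuclideanSpace ℝ (Fin n))).real {z | ‖z‖ ^ 2 < q} = (chiSq n).real (Set.Iio q) := by
  rw [← map_pi_eq_stdGaussian, chiSq, map_measureReal_apply (by fun_prop) measurableSet_Iio,
    map_measureReal_apply (by fun_prop)
      (measurableSet_lt (by fun_prop) measurable_const)]
  congr 1
  ext z
  simp [EuclideanSpace.real_norm_sq_eq]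

open scoped MatrixOrder in
theorem norm_sq_toEuclideanCLM_sqrt_le {S : Matrix (Fin n) (Fin n) ℝ} (hS : S.PosSemidef)
    (z : EuclideanSpace ℝ (Fin n)) :
    ‖toEuclideanCLM (n := Fin n) (𝕜 := ℝ) (CFC.sqrt S) z‖ ^ 2 ≤ specNorm S * ‖z‖ ^ 2 := by
  refine le_trans (le_of_eq ?_) (dotProduct_mulVec_le_specNorm S z)
  have h : (CFC.sqrt S)ᵀ = CFC.sqrt S := by
    rw [← conjTranspose_eq_transpose_of_trivial]
    exact (CFC.sqrt_nonneg S).posSemidef.1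
  rw [← real_inner_self_eq_norm_sq, inner_toEuclideanCLM_right, h,
    ← mul_apply_eq_comp, ← map_mul, CFC.sqrt_mul_sqrt_self _ hS.nonneg,
    inner_toEuclideanCLM]

open scoped MatrixOrder in
/-- The concentration of a Gaussian vector with a small covariance matrix. -/
theorem le_multivariateGaussian_real_ball (hn : 1 ≤ n) {p ε : ℝ} (hp0 : 0 < p) (hp1 : p < 1)
    (hε : 0 < ε) {S : Matrix (Fin n) (Fin n) ℝ} (hS : S.PosSemidef)
    (hle : specNorm S ≤ ε ^ 2 / chiSqQuantile n p) :
    p ≤ (multivariateGaussian (0 : EuclideanSpace ℝ (Fin n)) S).real {z | ‖z‖ < ε} := by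
  obtain ⟨hq, hcdf⟩ := chiSqQuantile_pos_and_le_cdf hn hp0 hp1
  set q := chiSqQuantile n p
  calc p ≤ (chiSq n).real (Set.Iic q) := by rwa [← cdf_eq_real]
    -- The absence of atoms allows the strict inequality `‖z‖ ^ 2 < q`, which is what yields the
    -- open ball.
    _ = (chiSq n).real (Set.Iio q) := by
      rw [← Set.Iio_union_right]
      refine measureReal_congr (union_ae_eq_left_of_ae_eq_empty ?_)
      exact ae_eq_empty.2 (chiSq_singleton hn q)
    _ = (stdGaussian (EuclideanSpace ℝ (Fin n))).real {z | ‖z‖ ^ 2 < q} :=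
      (stdGaussian_real_norm_sq_lt q).symm
    _ ≤ _ := by
      rw [multivariateGaussian, map_measureReal_apply (by fun_prop)
        (measurableSet_lt (by fun_prop) measurable_const)]
      refine measureReal_mono fun z hz => ?_
      have hz' : ‖z‖ ^ 2 < q := hz
      show ‖0 + toEuclideanCLM (n := Fin n) (𝕜 := ℝ) (CFC.sqrt S) z‖ < ε
      rw [zero_add]
      refine lt_of_pow_lt_pow_left₀ 2 hε.le ((norm_sq_toEuclideanCLM_sqrt_le hS z).trans_lt ?_)
      calc specNorm S * ‖z‖ ^ 2 ≤ ε ^ 2 / q * ‖z‖ ^ 2 := by gcongr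
        _ < ε ^ 2 / q * q := by gcongr
        _ = ε ^ 2 := by field_simp

theorem posSemidef_foldl_covStep {S Sw : Matrix (Fin n) (Fin n) ℝ} (hS : S.PosSemidef)
    (hSw : Sw.PosSemidef) (as : List (EuclideanSpace ℝ (Fin n))) :
    (as.foldl (covStep Sw) S).PosSemidef := by
  induction as generalizing S with
  | nil => exact hS
  | cons a as ih => exact ih (PosSemidef.covStep hS hSw a)

end InfoGreedy

end

theorem mainTheorem7 {n : ℕ} (hn : 1 ≤ n)
    {Ω : Type*} [MeasurableSpace Ω] (P : Measure Ω) [IsProbabilityMeasure P]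
    (μ : EuclideanSpace ℝ (Fin n)) (S Sw : Matrix (Fin n) (Fin n) ℝ)
    (hS : S.PosSemidef) (hSw : Sw.PosDef)
    (x : Ω → EuclideanSpace ℝ (Fin n)) (w : ℕ → Ω → EuclideanSpace ℝ (Fin n))
    (hx : HasLaw x (multivariateGaussian μ S) P)
    (hw : ∀ t, HasLaw (w t) (multivariateGaussian 0 Sw) P)
    (hw_indep : iIndepFun w P)
    (hxw_indep : IndepFun x (fun ω t => w t ω) P)
    (ε p : ℝ) (hε : 0 < ε) (hp0 : 0 < p) (hp1 : p < 1)
    (u : Matrix (Fin n) (Fin n) ℝ → EuclideanSpace ℝ (Fin n))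
    (hu : InfoGreedy.IsDirectionRule Sw u)
    (r : Matrix (Fin n) (Fin n) ℝ → ℕ)
    (hr : InfoGreedy.IsRepetitionRule Sw ε p r) :
    ∃ out : Ω → InfoGreedy.State n,
      (∀ ω, InfoGreedy.Outputs μ S Sw ε p u r
        (fun t a => inner ℝ a (x ω + w t ω)) (out ω)) ∧
      (∀ ω, ((out ω).count : ℤ) ≤ InfoGreedy.measurementBound S Sw ε p) ∧
      p ≤ P.real {ω | ‖x ω - (out ω).mean‖ < ε} := by

  obtain ⟨hq, -⟩ := InfoGreedy.chiSqQuantile_pos_and_le_cdf hn hp0 hp1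
  -- The list `as` is obtained before `ω`, so the same linear formula for the error holds at every
  -- sample point.
  obtain ⟨as, hlen, hnorm, hrun⟩ := InfoGreedy.exists_directions hSw hε hq hu hr S hS
  refine ⟨fun ω => as.foldl (fun s a => InfoGreedy.measureOnce Sw
    (fun t a => inner ℝ a (x ω + w t ω)) a s) ⟨μ, S, 0⟩, fun ω => hrun _ μ 0, fun ω => ?_, ?_⟩
  · rw [InfoGreedy.foldl_measureOnce_count, InfoGreedy.measurementBound_eq_potential]
    simpa using hlen
  · have hlaw := InfoGreedy.hasLaw_error hS hSw.posSemidef hx hw hw_indep hxw_indep as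
    have hball := InfoGreedy.le_multivariateGaussian_real_ball hn hp0 hp1 hε
      (InfoGreedy.posSemidef_foldl_covStep hS hSw.posSemidef as) hnorm
    rwa [← hlaw.measureReal_eq (p := fun z => ‖z‖ < ε)
      (measurableSet_lt (by fun_prop) measurable_const)] at hball
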